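/- Let $A$ be a finite-dimensional Hopf algebra over an algebraically closed field $\Bbbk$, with coproduct $\Delta(x)=\sum_x x_{(1)}\otimes x_{(2)}$, counit $\varepsilon$ and antipode $S$; all modules are finite-dimensional left modules. For $A$-modules $U,W$ the tensor product $U\otimes W$ (over $\Bbbk$) is the $A$-module with $x(u\otimes w)=\sum_x x_{(1)}u\otimes x_{(2)}w$, and the dual $V^*=\operatorname{Hom}_\Bbbk(V,\Bbbk)$ is the $A$-module with $(xf)(v)=f(S(x)v)$. Write $\operatorname{tr}_V(x)\in\Bbbk$ for the trace of $x\in A$ on $V$. Let $S_1,\dots,S_m$ be representatives of the isomorphism classes of simple $A$-modules and let $P_j$ be the projective cover of $S_j$, that is, the indecomposable projective module whose quotient by its radical is isomorphic to $S_j$. For an $A$-module $V$ let $M_V=([S_i\otimes V:S_j])_{i,j}$ be its McKay matrix, where $[\,\cdot:S_j]$ is the multiplicity of $S_j$ as a composition factor. Put $$\operatorname{Tr}_P(x)=[\operatorname{tr}_{P_1}(x)\ \cdots\ \operatorname{tr}_{P_m}(x)]\in\Bbbk^m,\qquad \mathbf p=[\dim P_1\ \cdots\ \dim P_m]\in\mathbb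 Z^m .$$ In equations over $\Bbbk$ the integer entries of $M_V$ are read in $\Bbbk$. A left eigenvector is by definition nonzero. **Theorem.** Let $V$ be an $A$-module. 1. For all $x\in A$, $\ \operatorname{Tr}_P(x)\,M_{V^*}=\sum_x \operatorname{tr}_V(x_{(2)})\operatorname{Tr}_P(x_{(1)})$. 2. If $(V^*)^*\cong V$ as $A$-modules, then for all $x\in A$, $\ \operatorname{Tr}_P(x)\,M_V=\sum_x \operatorname{tr}_{V^*}(x_{(2)})\operatorname{Tr}_P(x_{(1)})$. **Corollary.** Suppose that $(V^*)^*\cong V$. (a) For every grouplike $g\in A$ (that is, $\Delta(g)=g\otimes g$ and $\varepsilon(g)=1$), $\ \operatorname{Tr}_P(g)\,M_V=\operatorname{tr}_{V^*}(g)\operatorname{Tr}_P(g)$. Hence, if $\operatorname{Tr}_P(g)\neq 0$, then $\operatorname{Tr}_P(g)$ is a left eigenvector of $M_V$ with eigenvalue $\operatorname{tr}_{V^*}(g)$. For $g=1$, $\operatorname{Tr}_P(1)$ is the image of $\mathbf p$ in $\Bbbk^m$, and, in $\Bbbk$, $\operatorname{tr}_{V^*}(1)=\dim V^*=\dim V=\operatorname{tr}_V(1)$,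 the middle equality holding already for integers. Moreover the vector $\mathbf p$ is, over $\mathbb Z$, a left eigenvector of the integer matrix $M_V$ with eigenvalue $\dim V$; in particular $\mathbf p\ne 0$. (b) If $x\in A$ satisfies $\Delta(x)=x\otimes y+z\otimes x$ with nonzero $y,z\in A$, then $\ \operatorname{Tr}_P(x)\,M_V=\operatorname{tr}_{V^*}(y)\operatorname{Tr}_P(x)+\operatorname{tr}_{V^*}(x)\operatorname{Tr}_P(z)$. -/

import Mathlib

open scoped TensorProduct Matrix

universe u

/-! ### Modules over a Hopf algebra: tensor products, duals, traces -/

section HopfModules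

variable (k A V W : Type*) [Field k] [Ring A] [HopfAlgebra k A]
  [AddCommGroup V] [Module k V] [Module A V] [IsScalarTower k A V]
  [AddCommGroup W] [Module k W] [Module A W] [IsScalarTower k A W]

/-- The action `A → End_k V` of the algebra `A` on the `A`-module `V`. -/
def moduleAction : A →ₐ[k] Module.End k V := Algebra.lsmul k k V

/-- `tr_V(x)`: the trace of the action of `x ∈ A` on `V`. -/
noncomputable def moduleTrace (x : A) : k := LinearMap.trace k V (moduleAction k A V x)

set_option linter.unusedVariables false in
/-- The vector space `V ⊗ W` over `k`, which will carry the `A`-action given by the coproduct.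
(A type synonym: the name `A` is kept in the type so that this action does not get confused with
the action of `A` on the left factor only.) -/
@[nolint unusedArguments]
def HopfTensor (k A V W : Type*) [Field k] [AddCommGroup V] [Module k V]
    [AddCommGroup W] [Module k W] : Type _ := V ⊗[k] W

set_option linter.unusedVariables false in
/-- The dual vector space of `V` over `k`, which will carry the `A`-action given by the antipode. -/
@[nolint unusedArguments]
def HopfDual (k A V : Type*) [Field k] [AddCommGroup V] [Module k V] : Type _ := V →ₗ[k] k

noncomputable instance : AddCommGroup (HopfTensor k A V W) :=
  inferInstanceAs (AddCommGroup (V ⊗[k] W))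

noncomputable instance : Module k (HopfTensor k A V W) :=
  inferInstanceAs (Module k (V ⊗[k] W))

instance [FiniteDimensional k V] [FiniteDimensional k W] :
    FiniteDimensional k (HopfTensor k A V W) :=
  inferInstanceAs (FiniteDimensional k (V ⊗[k] W))

noncomputable instance : AddCommGroup (HopfDual k A V) :=
  inferInstanceAs (AddCommGroup (V →ₗ[k] k))

noncomputable instance : Module k (HopfDual k A V) :=
  inferInstanceAs (Module k (V →ₗ[k] k))

instance [FiniteDimensional k V] : FiniteDimensional k (HopfDual k A V) :=
  inferInstanceAs (FiniteDimensional k (V →ₗ[k] k))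

/-- The action of `A` on `V ⊗ W` through the coproduct:
`x · (v ⊗ w) = ∑ (x₁ · v) ⊗ (x₂ · w)` where `Δ(x) = ∑ x₁ ⊗ x₂`. -/
noncomputable def tensorAction : A →ₐ[k] Module.End k (V ⊗[k] W) :=
  (Module.endTensorEndAlgHom (R := k) (S := k) (A := k) (M := V) (N := W)).comp
    ((Algebra.TensorProduct.map (moduleAction k A V) (moduleAction k A W)).comp
      (Bialgebra.comulAlgHom k A))

/-- The action of `A` on the dual of `V` through the antipode: `(x · f)(v) = f(S(x) · v)`. -/
noncomputable def dualAction : A →+* Module.End k (V →ₗ[k] k) where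
  toFun x := LinearMap.lcomp k k (moduleAction k A V (HopfAlgebra.antipode k x))
  map_one' := by ext f v; simp
  map_mul' x y := by ext f v; simp [HopfAlgebra.antipode_mul_antidistrib]
  map_zero' := by ext f v; simp
  map_add' x y := by ext f v; simp

noncomputable instance : Module A (HopfTensor k A V W) :=
  Module.compHom (V ⊗[k] W) (tensorAction k A V W).toRingHom

noncomputable instance : Module A (HopfDual k A V) :=
  Module.compHom (V →ₗ[k] k) (dualAction k A V)

/-- The identification of the vector space `V ⊗ W` with the underlying space of `HopfTensor`. -/
noncomputable def HopfTensor.equiv : (V ⊗[k] W) ≃ₗ[k] HopfTensor k A V W :=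
  LinearEquiv.refl k (V ⊗[k] W)

/-- The identification of the dual space of `V` with the underlying space of `HopfDual`. -/
noncomputable def HopfDual.equiv : (V →ₗ[k] k) ≃ₗ[k] HopfDual k A V :=
  LinearEquiv.refl k (V →ₗ[k] k)

theorem HopfTensor.smul_equiv (x : A) (t : V ⊗[k] W) :
    x • HopfTensor.equiv k A V W t = HopfTensor.equiv k A V W (tensorAction k A V W x t) := rfl

theorem HopfTensor.smul_tmul {κ : Type*} (x : A) (R : Coalgebra.Repr k x κ) (v : V) (w : W) :
    x • HopfTensor.equiv k A V W (v ⊗ₜ[k] w) =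
      HopfTensor.equiv k A V W (∑ i ∈ R.index, (R.left i • v) ⊗ₜ[k] (R.right i • w)) := by
  rw [HopfTensor.smul_equiv]
  congr 1
  simp [tensorAction, moduleAction, ← R.eq, map_sum, LinearMap.sum_apply,
    Module.endTensorEndAlgHom_apply]

theorem HopfDual.smul_equiv (x : A) (f : V →ₗ[k] k) :
    x • HopfDual.equiv k A V f = HopfDual.equiv k A V (dualAction k A V x f) := rfl

theorem dualAction_apply (x : A) (f : V →ₗ[k] k) (v : V) :
    dualAction k A V x f v = f (HopfAlgebra.antipode k x • v) := rfl

instance : IsScalarTower k A (HopfTensor k A V W) where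
  smul_assoc c x t := by
    obtain ⟨t, rfl⟩ := (HopfTensor.equiv k A V W).surjective t
    simp only [HopfTensor.smul_equiv, map_smul, LinearMap.smul_apply]

instance : IsScalarTower k A (HopfDual k A V) where
  smul_assoc c x f := by
    obtain ⟨f, rfl⟩ := (HopfDual.equiv k A V).surjective f
    have h : dualAction k A V (c • x) f = c • dualAction k A V x f := by
      ext v
      simp [dualAction_apply]
    rw [HopfDual.smul_equiv, HopfDual.smul_equiv, h, map_smul]

end HopfModules

/-! ### Composition multiplicities -/

section Multiplicity

variable {A M : Type*} [Ring A] [AddCommGroup M] [Module A M]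

/-- The number of factors of the composition series `s` of submodules of `M` that are isomorphic
to the module `T`. -/
noncomputable def compositionCount (s : CompositionSeries (Submodule A M))
    (T : Type*) [AddCommGroup T] [Module A T] : ℕ :=
  Nat.card {i : Fin s.length //
    Nonempty ((s i.succ ⧸ (s i.castSucc).comap (s i.succ).subtype) ≃ₗ[A] T)}

open Classical in
/-- `[M : T]`, the multiplicity of the simple module `T` as a composition factor of the module `M`
of finite length: the number of factors isomorphic to `T` in any composition series of `M`. -/
noncomputable def compositionMultiplicity (A M T : Type*) [Ring A] [AddCommGroup M] [Module A M]
    [AddCommGroup T] [Module A T] : ℕ :=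
  if h : ∃ s : CompositionSeries (Submodule A M), s.head = ⊥ ∧ s.last = ⊤ then
    compositionCount h.choose T
  else 0

/-- The multiplicity does not depend on the composition series. -/
theorem compositionMultiplicity_eq (T : Type*) [AddCommGroup T] [Module A T]
    (s : CompositionSeries (Submodule A M)) (h₁ : s.head = ⊥) (h₂ : s.last = ⊤) :
    compositionMultiplicity A M T = compositionCount s T := by
  have h : ∃ s : CompositionSeries (Submodule A M), s.head = ⊥ ∧ s.last = ⊤ := ⟨s, h₁, h₂⟩
  rw [compositionMultiplicity, dif_pos h]
  obtain ⟨f, hf⟩ := CompositionSeries.jordan_holder h.choose s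
    (h.choose_spec.1.trans h₁.symm) (h.choose_spec.2.trans h₂.symm)
  refine Nat.card_congr (f.subtypeEquiv fun i => ?_)
  have e := (hf i).linearEquiv
  exact ⟨fun ⟨g⟩ => ⟨e.symm.trans g⟩, fun ⟨g⟩ => ⟨e.trans g⟩⟩

end Multiplicity

/-! ### Simple modules, projective covers, McKay matrices -/

/-- `S` is a complete list, without repetition, of the simple `A`-modules up to isomorphism.
(Every simple `A`-module is a quotient of `A`, so it is enough to look at the simple modules in the
universe of `A`.) -/
structure IsCompleteSimpleFamily (A : Type u) [Ring A] {ι : Type*} (S : ι → Type*)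
    [∀ i, AddCommGroup (S i)] [∀ i, Module A (S i)] : Prop where
  simple : ∀ i, IsSimpleModule A (S i)
  pairwise : ∀ i j, Nonempty (S i ≃ₗ[A] S j) → i = j
  complete : ∀ (T : Type u) [AddCommGroup T] [Module A T] [IsSimpleModule A T],
    ∃ i, Nonempty (T ≃ₗ[A] S i)

/-- A module is indecomposable if it is nonzero and is not the direct sum of two nonzero
submodules. -/
def IsIndecomposableModule (A M : Type*) [Ring A] [AddCommGroup M] [Module A M] : Prop :=
  Nontrivial M ∧ ∀ N N' : Submodule A M, IsCompl N N' → N = ⊥ ∨ N' = ⊥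

/-- `P` is the projective cover of the simple module `S`: it is an indecomposable projective module
such that `P` modulo its radical is isomorphic to `S`. -/
structure IsProjectiveCoverOfSimple (A P S : Type*) [Ring A] [AddCommGroup P] [Module A P]
    [AddCommGroup S] [Module A S] : Prop where
  projective : Module.Projective A P
  indecomposable : IsIndecomposableModule A P
  top : Nonempty ((P ⧸ Module.jacobson A P) ≃ₗ[A] S)

section McKay

variable (k A : Type*) [Field k] [Ring A] [HopfAlgebra k A] {ι : Type*}

/-- The McKay matrix `M_V`, with entries `(M_V)_{ij} = [S_i ⊗ V : S_j]`. -/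
noncomputable def mcKayMatrix (S : ι → Type*) [∀ i, AddCommGroup (S i)] [∀ i, Module k (S i)]
    [∀ i, Module A (S i)] [∀ i, IsScalarTower k A (S i)]
    (V : Type*) [AddCommGroup V] [Module k V] [Module A V] [IsScalarTower k A V] :
    Matrix ι ι ℕ :=
  Matrix.of fun i j => compositionMultiplicity A (HopfTensor k A (S i) V) (S j)

/-- The row vector `Tr_P(x) = [tr_{P_1}(x), …, tr_{P_m}(x)]`. -/
noncomputable def traceVector (P : ι → Type*) [∀ i, AddCommGroup (P i)] [∀ i, Module k (P i)]
    [∀ i, Module A (P i)] [∀ i, IsScalarTower k A (P i)] (x : A) : ι → k :=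
  fun i => moduleTrace k A (P i) x

/-- The dimension vector `p = [dim P_1, …, dim P_m]`, a vector of integers. -/
noncomputable def dimensionVector (P : ι → Type*) [∀ i, AddCommGroup (P i)]
    [∀ i, Module k (P i)] : ι → ℤ :=
  fun i => (Module.finrank k (P i) : ℤ)

end McKay

/-- The nonzero row vector `w` is a left eigenvector of the square matrix `M`
with eigenvalue `c`. -/
def IsLeftEigenvector {R ι : Type*} [CommRing R] [Fintype ι] (M : Matrix ι ι R) (c : R)
    (w : ι → R) : Prop :=
  w ≠ 0 ∧ w ᵥ* M = c • w

set_option linter.unusedSectionVars false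

section ProjectiveCovers

variable {k A : Type*} [Field k] [Ring A] [Algebra k A]

theorem moduleTrace_congr {A M N : Type*} [Ring A] [HopfAlgebra k A]
    [AddCommGroup M] [Module k M] [Module A M] [IsScalarTower k A M]
    [AddCommGroup N] [Module k N] [Module A N] [IsScalarTower k A N]
    (e : M ≃ₗ[A] N) (x : A) : moduleTrace k A M x = moduleTrace k A N x := by
  rw [moduleTrace, moduleTrace, ← LinearMap.trace_conj' _ (e.restrictScalars k)]
  congr 1
  ext n
  simp [moduleAction, LinearEquiv.conj_apply]

theorem moduleTrace_prod {A M N : Type*} [Ring A] [HopfAlgebra k A]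
    [AddCommGroup M] [Module k M] [Module A M] [IsScalarTower k A M] [FiniteDimensional k M]
    [AddCommGroup N] [Module k N] [Module A N] [IsScalarTower k A N] [FiniteDimensional k N]
    (x : A) : moduleTrace k A (M × N) x = moduleTrace k A M x + moduleTrace k A N x := by
  rw [moduleTrace, moduleTrace, moduleTrace, ← LinearMap.trace_prodMap']
  rfl

theorem moduleTrace_one {A M : Type*} [Ring A] [HopfAlgebra k A]
    [AddCommGroup M] [Module k M] [Module A M] [IsScalarTower k A M] [FiniteDimensional k M] :
    moduleTrace k A M 1 = (Module.finrank k M : k) := by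
  rw [moduleTrace, map_one, LinearMap.trace_one]

theorem moduleTrace_of_subsingleton {A M : Type*} [Ring A] [HopfAlgebra k A]
    [AddCommGroup M] [Module k M] [Module A M] [IsScalarTower k A M] [Subsingleton M] (x : A) :
    moduleTrace k A M x = 0 := by
  rw [moduleTrace, Subsingleton.elim (moduleAction k A M x) 0, map_zero]

/-- A linear map to a module which becomes surjective modulo the radical is surjective. -/
theorem LinearMap.surjective_of_mkQ_jacobson_comp {A M N : Type*} [Ring A] [AddCommGroup M]
    [Module A M] [AddCommGroup N] [Module A N] [Module.Finite A N] (f : M →ₗ[A] N)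
    (h : Function.Surjective ((Module.jacobson A N).mkQ ∘ₗ f)) : Function.Surjective f := by
  rw [← LinearMap.range_eq_top]
  by_contra hne
  obtain ⟨m, hm, hle⟩ := (eq_top_or_exists_le_coatom (LinearMap.range f)).resolve_left hne
  have hJ : Module.jacobson A N ≤ m := sInf_le hm
  refine hm.1 (eq_top_iff.2 fun n _ => ?_)
  obtain ⟨a, ha⟩ := h ((Module.jacobson A N).mkQ n)
  have hmem : n - f a ∈ Module.jacobson A N := by
    rw [← (Submodule.Quotient.eq _)]
    exact ha.symm
  have := m.add_mem (hJ hmem) (hle (LinearMap.mem_range_self f a))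
  simpa using this

theorem jacobson_le_ker {A M T : Type*} [Ring A] [AddCommGroup M] [Module A M]
    [AddCommGroup T] [Module A T] [IsSimpleModule A T] (f : M →ₗ[A] T) :
    Module.jacobson A M ≤ LinearMap.ker f := by
  have h := Module.le_comap_jacobson f
  rwa [IsSimpleModule.jacobson_eq_bot A T] at h

section Hom

variable {P M T : Type*}
  [AddCommGroup P] [Module k P] [Module A P] [IsScalarTower k A P]
  [AddCommGroup M] [Module k M] [Module A M] [IsScalarTower k A M]
  [AddCommGroup T] [Module k T] [Module A T] [IsScalarTower k A T]

theorem finrank_hom_congr_right {P M M' : Type*} [AddCommGroup P] [Module A P]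
    [AddCommGroup M] [Module k M] [Module A M] [IsScalarTower k A M] [AddCommGroup M'] [Module k M'] [Module A M']
    [IsScalarTower k A M'] (e : M ≃ₗ[A] M') :
    Module.finrank k (P →ₗ[A] M) = Module.finrank k (P →ₗ[A] M') := by
  refine LinearEquiv.finrank_eq (R := k)
    { toFun := fun f => e.toLinearMap ∘ₗ f
      invFun := fun f => e.symm.toLinearMap ∘ₗ f
      map_add' := fun f g => by ext; simp
      map_smul' := fun c f => by ext p; exact (e.restrictScalars k).map_smul c (f p)
      left_inv := fun f => by ext; simp
      right_inv := fun f => by ext; simp }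

theorem finrank_hom_congr_left {P P' M : Type*} [AddCommGroup P] [Module A P]
    [AddCommGroup P'] [Module A P'] [AddCommGroup M] [Module k M] [Module A M] [IsScalarTower k A M]
    (e : P ≃ₗ[A] P') :
    Module.finrank k (P →ₗ[A] M) = Module.finrank k (P' →ₗ[A] M) :=
  (LinearEquiv.congrLeft M k e).finrank_eq

/-- `Hom(P, -)` is exact when `P` is projective. -/
theorem finrank_hom_eq_add [FiniteDimensional k P] [FiniteDimensional k M]
    (hP : Module.Projective A P) (N : Submodule A M) :
    Module.finrank k (P →ₗ[A] M) =
      Module.finrank k (P →ₗ[A] N) + Module.finrank k (P →ₗ[A] (M ⧸ N)) := by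
  let φ : (P →ₗ[A] M) →ₗ[k] (P →ₗ[A] (M ⧸ N)) :=
    { toFun := fun f => N.mkQ ∘ₗ f
      map_add' := fun f g => by ext; simp
      map_smul' := fun c f => by ext; rfl }
  let ψ : (P →ₗ[A] N) →ₗ[k] (P →ₗ[A] M) :=
    { toFun := fun f => N.subtype ∘ₗ f
      map_add' := fun f g => by ext; simp
      map_smul' := fun c f => by ext; rfl }
  have hφ : LinearMap.range φ = ⊤ := LinearMap.range_eq_top.2 fun g =>
    Module.projective_lifting_property N.mkQ g N.mkQ_surjective
  have hψ : Function.Injective ψ := fun f g h => by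
    ext p
    exact LinearMap.congr_fun h p
  have hker : LinearMap.ker φ = LinearMap.range ψ := by
    ext f
    constructor
    · intro hf
      have hf' : ∀ p, f p ∈ N := fun p => by
        have := LinearMap.congr_fun (LinearMap.mem_ker.1 hf) p
        exact (Submodule.Quotient.mk_eq_zero N).1 this
      exact ⟨f.codRestrict N hf', by ext; rfl⟩
    · rintro ⟨g, rfl⟩
      ext p
      exact (Submodule.Quotient.mk_eq_zero N).2 (g p).2
  have h := LinearMap.finrank_range_add_finrank_ker φ
  rw [hφ, finrank_top, hker, LinearMap.finrank_range_of_inj hψ] at h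
  omega

open Classical in
/-- The space of homomorphisms from the projective cover of `T'` to a simple module `T` is one or
zero dimensional, according to whether `T` is isomorphic to `T'` or not. -/
theorem IsProjectiveCoverOfSimple.finrank_hom_of_isSimpleModule [IsAlgClosed k]
    {T' : Type*} [AddCommGroup T'] [Module A T'] [IsSimpleModule A T']
    (hP : IsProjectiveCoverOfSimple A P T') [FiniteDimensional k P] [FiniteDimensional k T]
    [IsSimpleModule A T] :
    Module.finrank k (P →ₗ[A] T) = if Nonempty (T ≃ₗ[A] T') then 1 else 0 := by
  obtain ⟨t⟩ := hP.top
  have : IsSimpleModule A (P ⧸ Module.jacobson A P) := IsSimpleModule.congr t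
  split_ifs with h
  · obtain ⟨e⟩ := h
    let ε : (P ⧸ Module.jacobson A P) ≃ₗ[A] T := t.trans e.symm
    refine (finrank_eq_one_iff' ).2 ⟨ε.toLinearMap ∘ₗ (Module.jacobson A P).mkQ, ?_, fun f => ?_⟩
    · intro h0
      have : Nontrivial T := IsSimpleModule.nontrivial A T
      obtain ⟨y, hy⟩ := exists_ne (0 : T)
      obtain ⟨p, hp⟩ := (Module.jacobson A P).mkQ_surjective (ε.symm y)
      apply hy
      have := LinearMap.congr_fun h0 p
      simpa [hp] using this
    · obtain ⟨c, hc⟩ := (IsSimpleModule.algebraMap_end_bijective_of_isAlgClosed (A := A) (V := T)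
        k).2 (((Module.jacobson A P).liftQ f (jacobson_le_ker f)) ∘ₗ ε.symm.toLinearMap)
      refine ⟨c, ?_⟩
      ext p
      have := LinearMap.congr_fun hc (ε ((Module.jacobson A P).mkQ p))
      simpa using this
  · suffices h0 : ∀ f : P →ₗ[A] T, f = 0 by
      have : Subsingleton (P →ₗ[A] T) := ⟨fun f g => (h0 f).trans (h0 g).symm⟩
      exact Module.finrank_zero_of_subsingleton
    intro f
    rcases LinearMap.bijective_or_eq_zero
      ((Module.jacobson A P).liftQ f (jacobson_le_ker f)) with hb | h0
    · exact (h ⟨(LinearEquiv.ofBijective _ hb).symm.trans t⟩).elim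
    · rw [← (Module.jacobson A P).liftQ_mkQ f (jacobson_le_ker f), h0, LinearMap.zero_comp]

theorem Fin.apply_last_eq_add_sum {n : ℕ} (f : Fin (n + 1) → ℕ) (g : Fin n → ℕ)
    (h : ∀ i, f i.succ = f i.castSucc + g i) : f (Fin.last n) = f 0 + ∑ i, g i := by
  induction n with
  | zero => simp
  | succ n ih =>
    have := ih (fun i => f i.castSucc) (fun i => g i.castSucc) fun i => h i.castSucc
    rw [Fin.sum_univ_castSucc, ← Fin.succ_last, h, this, add_assoc]
    rfl

open Classical in
theorem IsProjectiveCoverOfSimple.finrank_hom_of_isSimpleModule_quotient [IsAlgClosed k]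
    {T' : Type*} [AddCommGroup T'] [Module A T'] [IsSimpleModule A T']
    (hP : IsProjectiveCoverOfSimple A P T') [FiniteDimensional k P] [FiniteDimensional k M]
    (N : Submodule A M) [IsSimpleModule A (M ⧸ N)] :
    Module.finrank k (P →ₗ[A] M) = Module.finrank k (P →ₗ[A] N) +
      if Nonempty ((M ⧸ N) ≃ₗ[A] T') then 1 else 0 := by
  have : FiniteDimensional k (M ⧸ N) :=
    Module.Finite.of_surjective (N.mkQ.restrictScalars k) N.mkQ_surjective
  rw [finrank_hom_eq_add hP.projective N, hP.finrank_hom_of_isSimpleModule (T := M ⧸ N)]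

open Classical in
theorem IsProjectiveCoverOfSimple.finrank_hom_of_covBy [IsAlgClosed k]
    {T' : Type*} [AddCommGroup T'] [Module A T'] [IsSimpleModule A T']
    (hP : IsProjectiveCoverOfSimple A P T') [FiniteDimensional k P] [FiniteDimensional k M]
    {N N' : Submodule A M} (h : N ⋖ N') :
    Module.finrank k (P →ₗ[A] N') = Module.finrank k (P →ₗ[A] N) +
      if Nonempty ((N' ⧸ N.comap N'.subtype) ≃ₗ[A] T') then 1 else 0 := by
  have : IsSimpleModule A (N' ⧸ N.comap N'.subtype) := (covBy_iff_quot_is_simple h.le).1 h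
  have : FiniteDimensional k N' :=
    Module.Finite.of_injective (N'.subtype.restrictScalars k) N'.subtype_injective
  rw [hP.finrank_hom_of_isSimpleModule_quotient (k := k) (N.comap N'.subtype)]
  congr 1
  exact finrank_hom_congr_right (Submodule.comapSubtypeEquivOfLe h.le)

/-- The multiplicity of a simple module as a composition factor of `M` is the dimension of the
space of homomorphisms from its projective cover to `M`. -/
theorem IsProjectiveCoverOfSimple.compositionMultiplicity_eq_finrank_hom [IsAlgClosed k]
    {T' : Type*} [AddCommGroup T'] [Module A T'] [IsSimpleModule A T']
    (hP : IsProjectiveCoverOfSimple A P T') [FiniteDimensional k P] [FiniteDimensional k M]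
    [FiniteDimensional k A] :
    compositionMultiplicity A M T' = Module.finrank k (P →ₗ[A] M) := by
  classical
  have : IsNoetherianRing A := IsNoetherianRing.of_finite k A
  have : IsArtinianRing A := IsArtinianRing.of_finite k A
  have : Module.Finite A M := Module.Finite.of_restrictScalars_finite k A M
  obtain ⟨s, h₁, h₂⟩ := isFiniteLength_iff_exists_compositionSeries.1
    (isFiniteLength_iff_isNoetherian_isArtinian.2
      ⟨(inferInstance : IsNoetherian A M), (inferInstance : IsArtinian A M)⟩)
  rw [compositionMultiplicity_eq T' s h₁ h₂, compositionCount, Nat.card_eq_fintype_card,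
    Fintype.card_subtype, Finset.card_filter]
  have key := Fin.apply_last_eq_add_sum (fun i => Module.finrank k (P →ₗ[A] s i)) _
    fun i => hP.finrank_hom_of_covBy (k := k) (s.step i)
  have hlast : Module.finrank k (P →ₗ[A] s (Fin.last s.length)) =
      Module.finrank k (P →ₗ[A] M) :=
    finrank_hom_congr_right ((LinearEquiv.ofEq _ _ h₂).trans Submodule.topEquiv)
  have hhead : Module.finrank k (P →ₗ[A] s 0) = 0 := by
    have hbot : s 0 = ⊥ := h₁
    rw [hbot]
    have : Subsingleton (P →ₗ[A] (⊥ : Submodule A M)) :=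
      ⟨fun f g => by ext1; exact Subsingleton.elim _ _⟩
    exact Module.finrank_zero_of_subsingleton
  rw [hhead, zero_add, hlast] at key
  exact key.symm

end Hom

theorem IsSimpleModule.finiteDimensional (k A T : Type*) [Field k] [Ring A] [Algebra k A]
    [FiniteDimensional k A] [AddCommGroup T] [Module k T] [Module A T] [IsScalarTower k A T]
    [IsSimpleModule A T] : FiniteDimensional k T :=
  Module.Finite.trans A T

/-- Every nonzero finitely generated module has a simple quotient in a complete family. -/
theorem IsCompleteSimpleFamily.exists_surjective {A : Type u} [Ring A] {ι : Type*} {S : ι → Type*}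
    [∀ i, AddCommGroup (S i)] [∀ i, Module A (S i)] (hS : IsCompleteSimpleFamily A S)
    (Q : Type*) [AddCommGroup Q] [Module A Q] [Module.Finite A Q] [Nontrivial Q] :
    ∃ i, ∃ f : Q →ₗ[A] S i, Function.Surjective f := by
  obtain ⟨m, hm, -⟩ := (eq_top_or_exists_le_coatom (⊥ : Submodule A Q)).resolve_left bot_ne_top
  have : IsSimpleModule A (Q ⧸ m) := isSimpleModule_iff_isCoatom.2 hm
  obtain ⟨I, hI, ⟨e⟩⟩ := isSimpleModule_iff_quot_maximal.1 this
  have : IsSimpleModule A (A ⧸ I) := IsSimpleModule.congr e.symm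
  obtain ⟨i, ⟨e'⟩⟩ := hS.complete (A ⧸ I)
  exact ⟨i, (e.trans e').toLinearMap ∘ₗ m.mkQ, (e.trans e').surjective.comp m.mkQ_surjective⟩

section Decomposition

variable {A : Type u} [Ring A] [HopfAlgebra k A] {ι : Type*}
  {S : ι → Type*} [∀ i, AddCommGroup (S i)] [∀ i, Module k (S i)] [∀ i, Module A (S i)]
  [∀ i, IsScalarTower k A (S i)]
  {P : ι → Type*} [∀ i, AddCommGroup (P i)] [∀ i, Module k (P i)] [∀ i, Module A (P i)]
  [∀ i, IsScalarTower k A (P i)] [∀ i, FiniteDimensional k (P i)]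

/-- A nonzero projective module has a projective cover of a simple module as a direct summand. -/
theorem IsCompleteSimpleFamily.exists_equiv_prod (hS : IsCompleteSimpleFamily A S)
    (hP : ∀ i, IsProjectiveCoverOfSimple A (P i) (S i)) {Q : Type*} [AddCommGroup Q] [Module k Q]
    [Module A Q] [IsScalarTower k A Q] [FiniteDimensional k Q] (hQ : Module.Projective A Q)
    [Nontrivial Q] :
    ∃ i, ∃ K : Submodule A Q, Module.Projective A K ∧ Nonempty (Q ≃ₗ[A] (P i × K)) := by
  have : Module.Finite A Q := Module.Finite.of_restrictScalars_finite k A Q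
  obtain ⟨i, f, hf⟩ := hS.exists_surjective Q
  have : Module.Finite A (P i) := Module.Finite.of_restrictScalars_finite k A (P i)
  obtain ⟨t⟩ := (hP i).top
  obtain ⟨g, hg⟩ := Module.projective_lifting_property (Module.jacobson A (P i)).mkQ
    (t.symm.toLinearMap ∘ₗ f) (Submodule.mkQ_surjective _)
  have hgs : Function.Surjective g := g.surjective_of_mkQ_jacobson_comp <| by
    rw [hg]
    exact t.symm.surjective.comp hf
  have := (hP i).projective
  obtain ⟨r, hr⟩ := Module.projective_lifting_property g LinearMap.id hgs
  have hr' : ∀ p, g (r p) = p := fun p => LinearMap.congr_fun hr p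
  let c : Q →ₗ[A] LinearMap.ker g := (LinearMap.id - r ∘ₗ g).codRestrict _ fun q => by
    simp [hr']
  refine ⟨i, LinearMap.ker g, Module.Projective.of_split (LinearMap.ker g).subtype c ?_, ⟨?_⟩⟩
  · ext q
    simp [c]
  · refine LinearEquiv.ofLinearMap (g.prod c) (r.coprod (LinearMap.ker g).subtype) ?_ ?_
    · ext p <;> simp [c, hr']
    · ext q
      simp [c]

/-- Characters and dimensions of projective modules in terms of those of the indecomposable
projective modules. -/
theorem IsCompleteSimpleFamily.moduleTrace_and_finrank_eq_sum [IsAlgClosed k]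
    [FiniteDimensional k A] [Fintype ι]
    (hS : IsCompleteSimpleFamily A S) (hP : ∀ i, IsProjectiveCoverOfSimple A (P i) (S i))
    (n : ℕ) : ∀ (Q : Type*) [AddCommGroup Q] [Module k Q] [Module A Q] [IsScalarTower k A Q]
      [FiniteDimensional k Q], Module.Projective A Q → Module.finrank k Q = n →
      (∀ x, moduleTrace k A Q x =
        ∑ i, (Module.finrank k (Q →ₗ[A] S i) : k) * moduleTrace k A (P i) x) ∧
      Module.finrank k Q = ∑ i, Module.finrank k (Q →ₗ[A] S i) * Module.finrank k (P i) := by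
  classical
  induction n using Nat.strong_induction_on with
  | _ n ih =>
    intro Q _ _ _ _ _ hQ hn
    rcases subsingleton_or_nontrivial Q with hsub | hnt
    · have h0 : ∀ i, Module.finrank k (Q →ₗ[A] S i) = 0 := fun i => by
        have : Subsingleton (Q →ₗ[A] S i) := LinearMap.uniqueOfLeft.instSubsingleton
        exact Module.finrank_zero_of_subsingleton
      simp [h0, moduleTrace_of_subsingleton, Module.finrank_zero_of_subsingleton]
    · obtain ⟨j, K, hK, ⟨e⟩⟩ := hS.exists_equiv_prod (k := k) hP hQ
      have : FiniteDimensional k K := inferInstanceAs (FiniteDimensional k (K.restrictScalars k))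
      have hPj : Nontrivial (P j) := (hP j).indecomposable.1
      have hdim : Module.finrank k Q = Module.finrank k (P j) + Module.finrank k K := by
        rw [(e.restrictScalars k).finrank_eq, Module.finrank_prod]
      have hpos : 0 < Module.finrank k (P j) := Module.finrank_pos
      obtain ⟨ht, hd⟩ := ih _ (by omega) K hK rfl
      have hhom : ∀ i, Module.finrank k (Q →ₗ[A] S i) =
          (if i = j then 1 else 0) + Module.finrank k (K →ₗ[A] S i) := fun i => by
        have := hS.simple
        have : ∀ i, FiniteDimensional k (S i) := fun i => IsSimpleModule.finiteDimensional k A _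
        have hij : i = j ↔ Nonempty (S i ≃ₗ[A] S j) :=
          ⟨fun h => h ▸ ⟨LinearEquiv.refl A _⟩, hS.pairwise i j⟩
        rw [finrank_hom_congr_left e, ← (LinearMap.coprodEquiv (R := A) k).finrank_eq,
          Module.finrank_prod, (hP j).finrank_hom_of_isSimpleModule]
        simp only [hij]
      constructor
      · intro x
        rw [moduleTrace_congr e, moduleTrace_prod, ht]
        simp [hhom, add_mul, Finset.sum_add_distrib]
      · rw [hdim, hd]
        simp [hhom, add_mul, Finset.sum_add_distrib]

end Decomposition

end ProjectiveCovers

section Adjunction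

variable {k A : Type*} [Field k] [Ring A] [HopfAlgebra k A]
  {P V W : Type*} [AddCommGroup P] [Module k P] [Module A P] [IsScalarTower k A P]
  [AddCommGroup V] [Module k V] [Module A V] [IsScalarTower k A V]
  [AddCommGroup W] [Module k W] [Module A W] [IsScalarTower k A W]

theorem Coalgebra.sum_counit_right_smul {x : A} {κ : Type*} (R : Coalgebra.Repr k x κ) :
    ∑ i ∈ R.index, Coalgebra.counit (R := k) (R.right i) • R.left i = x := by
  simpa only [map_sum, _root_.TensorProduct.rid_tmul, one_smul] using
    congrArg (_root_.TensorProduct.rid k A) (Coalgebra.sum_tmul_counit_eq R)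

variable (k A V W) in
/-- The space `W ⊗ V*` as the space of linear maps from `V` to `W`. -/
noncomputable def hopfTensorDualEquivHom [FiniteDimensional k V] :
    HopfTensor k A W (HopfDual k A V) ≃ₗ[k] (V →ₗ[k] W) :=
  (HopfTensor.equiv k A W (HopfDual k A V)).symm ≪≫ₗ
    TensorProduct.congr (LinearEquiv.refl k W) (HopfDual.equiv k A V).symm ≪≫ₗ
      TensorProduct.comm k W (V →ₗ[k] k) ≪≫ₗ dualTensorHomEquiv k V W

theorem hopfTensorDualEquivHom_tmul [FiniteDimensional k V] (w : W) (f : V →ₗ[k] k) (v : V) :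
    hopfTensorDualEquivHom k A V W (HopfTensor.equiv k A W (HopfDual k A V)
      (w ⊗ₜ HopfDual.equiv k A V f)) v = f v • w := by
  simp [hopfTensorDualEquivHom]

theorem hopfTensorDual_induction {p : HopfTensor k A W (HopfDual k A V) → Prop}
    (h0 : p 0) (hadd : ∀ s t, p s → p t → p (s + t))
    (h : ∀ w f, p (HopfTensor.equiv k A W (HopfDual k A V) (w ⊗ₜ HopfDual.equiv k A V f)))
    (t : HopfTensor k A W (HopfDual k A V)) : p t := by
  obtain ⟨t, rfl⟩ := (HopfTensor.equiv k A W (HopfDual k A V)).surjective t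
  induction t with
  | zero => simpa using h0
  | add s t hs ht => rw [map_add]; exact hadd _ _ hs ht
  | tmul w f =>
    obtain ⟨f, rfl⟩ := (HopfDual.equiv k A V).surjective f
    exact h w f

theorem hopfTensorDualEquivHom_smul [FiniteDimensional k V] {x : A} {κ : Type*}
    (R : Coalgebra.Repr k x κ) (t : HopfTensor k A W (HopfDual k A V)) (v : V) :
    hopfTensorDualEquivHom k A V W (x • t) v = ∑ i ∈ R.index,
      R.left i • hopfTensorDualEquivHom k A V W t (HopfAlgebra.antipode k (R.right i) • v) := by
  induction t using hopfTensorDual_induction with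
  | h0 => simp
  | hadd s t hs ht => simp only [smul_add, map_add, LinearMap.add_apply, hs, ht,
      Finset.sum_add_distrib]
  | h w f =>
    rw [HopfTensor.smul_tmul k A W (HopfDual k A V) x R, map_sum, map_sum, LinearMap.sum_apply]
    refine Finset.sum_congr rfl fun i _ => ?_
    rw [HopfDual.smul_equiv, hopfTensorDualEquivHom_tmul, hopfTensorDualEquivHom_tmul,
      dualAction_apply, smul_comm]

theorem hopfTensorDualEquivHom_map [FiniteDimensional k V] {W' : Type*} [AddCommGroup W']
    [Module k W'] [Module A W'] [IsScalarTower k A W'] (f : W →ₗ[k] W')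
    (t : W ⊗[k] HopfDual k A V) :
    hopfTensorDualEquivHom k A V W' (HopfTensor.equiv k A W' (HopfDual k A V)
      (f.rTensor (HopfDual k A V) t)) =
      f ∘ₗ hopfTensorDualEquivHom k A V W (HopfTensor.equiv k A W (HopfDual k A V) t) := by
  induction t with
  | zero => simp
  | add s t hs ht => simp only [map_add, hs, ht, LinearMap.comp_add]
  | tmul w φ =>
    obtain ⟨φ, rfl⟩ := (HopfDual.equiv k A V).surjective φ
    ext v
    rw [LinearMap.rTensor_tmul, LinearMap.comp_apply, hopfTensorDualEquivHom_tmul,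
      hopfTensorDualEquivHom_tmul, map_smul]

theorem sum_tmul_mul_antipode {x : A} {κ : Type*} (R : Coalgebra.Repr k x κ) (p : P) (v : V) :
    ∑ i ∈ R.index, HopfTensor.equiv k A P V (tensorAction k A P V (R.left i)
      (p ⊗ₜ[k] (HopfAlgebra.antipode k (R.right i) • v))) =
    HopfTensor.equiv k A P V ((x • p) ⊗ₜ[k] v) := by
  have hl : ∀ i, tensorAction k A P V (R.left i)
      (p ⊗ₜ[k] (HopfAlgebra.antipode k (R.right i) • v)) =
      ∑ j ∈ (Coalgebra.Repr.arbitrary k (R.left i)).index,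
        ((Coalgebra.Repr.arbitrary k (R.left i)).left j • p) ⊗ₜ[k]
        ((Coalgebra.Repr.arbitrary k (R.left i)).right j •
          HopfAlgebra.antipode k (R.right i) • v) := fun i =>
    HopfTensor.smul_tmul k A P V (R.left i) (Coalgebra.Repr.arbitrary k (R.left i)) _ _
  let Φ : A ⊗[k] (A ⊗[k] A) →ₗ[k] P ⊗[k] V :=
    TensorProduct.map ((LinearMap.toSpanSingleton A P p).restrictScalars k)
      ((LinearMap.toSpanSingleton A V v).restrictScalars k ∘ₗ LinearMap.mul' k A ∘ₗ
        (HopfAlgebra.antipode k (A := A)).lTensor A)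
  have h := congrArg Φ (Coalgebra.sum_tmul_tmul_eq R
    (fun i => Coalgebra.Repr.arbitrary k (R.left i))
    (fun i => Coalgebra.Repr.arbitrary k (R.right i)))
  simp only [Φ, map_sum, TensorProduct.map_tmul, LinearMap.comp_apply, LinearMap.lTensor_tmul,
    LinearMap.mul'_apply, LinearMap.restrictScalars_apply, LinearMap.toSpanSingleton_apply,
    mul_smul] at h
  rw [← map_sum]
  congr 1
  rw [Finset.sum_congr rfl fun i _ => hl i, h]
  have : ∀ i, ∑ j ∈ (Coalgebra.Repr.arbitrary k (R.right i)).index,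
      (R.left i • p) ⊗ₜ[k] ((Coalgebra.Repr.arbitrary k (R.right i)).left j •
        HopfAlgebra.antipode k ((Coalgebra.Repr.arbitrary k (R.right i)).right j) • v) =
      (Coalgebra.counit (R := k) (R.right i) • R.left i • p) ⊗ₜ[k] v := fun i => by
    rw [← TensorProduct.tmul_sum]
    simp only [← mul_smul, ← Finset.sum_smul]
    rw [HopfAlgebra.sum_mul_antipode_eq_algebraMap_counit, algebraMap_smul,
      TensorProduct.tmul_smul, TensorProduct.smul_tmul']
  rw [Finset.sum_congr rfl fun i _ => this i, ← TensorProduct.sum_tmul]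
  congr 1
  simp only [← smul_assoc, ← Finset.sum_smul, Coalgebra.sum_counit_right_smul]

theorem sum_smul_hopfTensorDualEquivHom [FiniteDimensional k V] {x : A} {κ : Type*}
    (R : Coalgebra.Repr k x κ) (t : HopfTensor k A W (HopfDual k A V)) (v : V) :
    ∑ i ∈ R.index, hopfTensorDualEquivHom k A V W (R.left i • t) (R.right i • v) =
      x • hopfTensorDualEquivHom k A V W t v := by
  let Φ : A ⊗[k] (A ⊗[k] A) →ₗ[k] W :=
    TensorProduct.lift (Algebra.lsmul k k W).toLinearMap ∘ₗ
      (hopfTensorDualEquivHom k A V W t ∘ₗ (LinearMap.toSpanSingleton A V v).restrictScalars k ∘ₗ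
        LinearMap.mul' k A ∘ₗ (HopfAlgebra.antipode k (A := A)).rTensor A).lTensor A
  have h := congrArg Φ (Coalgebra.sum_tmul_tmul_eq R
    (fun i => Coalgebra.Repr.arbitrary k (R.left i))
    (fun i => Coalgebra.Repr.arbitrary k (R.right i)))
  simp only [Φ, map_sum, LinearMap.comp_apply, LinearMap.lTensor_tmul, LinearMap.rTensor_tmul,
    LinearMap.mul'_apply, LinearMap.restrictScalars_apply, LinearMap.toSpanSingleton_apply,
    TensorProduct.lift.tmul, AlgHom.toLinearMap_apply, Algebra.lsmul_coe] at h
  simp only [hopfTensorDualEquivHom_smul (Coalgebra.Repr.arbitrary k (R.left _)), ← mul_smul]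
  rw [h]
  have : ∀ i, ∑ j ∈ (Coalgebra.Repr.arbitrary k (R.right i)).index,
      R.left i • hopfTensorDualEquivHom k A V W t
        ((HopfAlgebra.antipode k ((Coalgebra.Repr.arbitrary k (R.right i)).left j) *
          (Coalgebra.Repr.arbitrary k (R.right i)).right j) • v) =
      (Coalgebra.counit (R := k) (R.right i) • R.left i) •
        hopfTensorDualEquivHom k A V W t v := fun i => by
    rw [← Finset.smul_sum, ← map_sum, ← Finset.sum_smul,
      HopfAlgebra.sum_antipode_mul_eq_algebraMap_counit, algebraMap_smul, map_smul, smul_comm,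
      smul_assoc]
  rw [Finset.sum_congr rfl fun i _ => this i, ← Finset.sum_smul, Coalgebra.sum_counit_right_smul]

/-- The functor `- ⊗ V` is left adjoint to `- ⊗ V*`. -/
noncomputable def hopfTensorHomEquiv [FiniteDimensional k V] :
    (HopfTensor k A P V →ₗ[A] W) ≃ₗ[k] (P →ₗ[A] HopfTensor k A W (HopfDual k A V)) where
  toFun g :=
    { toFun := fun p => (hopfTensorDualEquivHom k A V W).symm
        (TensorProduct.curry (g.restrictScalars k ∘ₗ (HopfTensor.equiv k A P V).toLinearMap) p)
      map_add' := fun p q => by simp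
      map_smul' := fun x p => by
        apply (hopfTensorDualEquivHom k A V W).injective
        ext v
        rw [RingHom.id_apply,
          hopfTensorDualEquivHom_smul (Coalgebra.Repr.arbitrary k x)]
        simp only [LinearEquiv.apply_symm_apply, TensorProduct.curry_apply, LinearMap.comp_apply,
          LinearMap.restrictScalars_apply, LinearEquiv.coe_coe, ← map_smul,
          HopfTensor.smul_equiv, ← map_sum g]
        rw [sum_tmul_mul_antipode] }
  map_add' g h := by
    ext p
    apply (hopfTensorDualEquivHom k A V W).injective
    ext v
    simp
  map_smul' c g := by
    ext p
    apply (hopfTensorDualEquivHom k A V W).injective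
    ext v
    simp
  invFun h :=
    { toFun := fun t => TensorProduct.lift ((hopfTensorDualEquivHom k A V W).toLinearMap ∘ₗ
        h.restrictScalars k) ((HopfTensor.equiv k A P V).symm t)
      map_add' := fun s t => by simp
      map_smul' := fun x t => by
        obtain ⟨t, rfl⟩ := (HopfTensor.equiv k A P V).surjective t
        induction t with
        | zero => simp
        | add s t hs ht =>
          simp only [map_add, smul_add, hs, ht]
        | tmul p v =>
          rw [HopfTensor.smul_tmul k A P V x (Coalgebra.Repr.arbitrary k x)]
          simp only [LinearEquiv.symm_apply_apply, map_sum, TensorProduct.lift.tmul,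
            LinearMap.comp_apply, LinearEquiv.coe_coe, LinearMap.restrictScalars_apply, map_smul,
            RingHom.id_apply]
          rw [sum_smul_hopfTensorDualEquivHom] }
  left_inv g := by
    ext t
    obtain ⟨t, rfl⟩ := (HopfTensor.equiv k A P V).surjective t
    induction t with
    | zero => simp
    | add s t hs ht => simp only [map_add, hs, ht]
    | tmul p v => simp
  right_inv h := by
    ext p
    apply (hopfTensorDualEquivHom k A V W).injective
    ext v
    simp

theorem hopfTensorHomEquiv_apply [FiniteDimensional k V] (g : HopfTensor k A P V →ₗ[A] W)
    (p : P) (v : V) :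
    hopfTensorDualEquivHom k A V W (hopfTensorHomEquiv g p) v =
      g (HopfTensor.equiv k A P V (p ⊗ₜ v)) := by
  simp [hopfTensorHomEquiv]

/-- The linear map `f ⊗ id` for an `A`-linear map `f`. -/
noncomputable def HopfTensor.mapLeft {W' : Type*} [AddCommGroup W']
    [Module k W'] [Module A W'] [IsScalarTower k A W'] (V : Type*) [AddCommGroup V] [Module k V]
    [Module A V] [IsScalarTower k A V] (f : W →ₗ[A] W') :
    HopfTensor k A W V →ₗ[A] HopfTensor k A W' V where
  toFun t := HopfTensor.equiv k A W' V
    ((f.restrictScalars k).rTensor V ((HopfTensor.equiv k A W V).symm t))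
  map_add' s t := by simp
  map_smul' x t := by
    obtain ⟨t, rfl⟩ := (HopfTensor.equiv k A W V).surjective t
    induction t with
    | zero => simp
    | add s t hs ht => simp only [map_add, smul_add, hs, ht]
    | tmul w v =>
      rw [HopfTensor.smul_tmul k A W V x (Coalgebra.Repr.arbitrary k x)]
      simp only [LinearEquiv.symm_apply_apply, LinearMap.rTensor_tmul, RingHom.id_apply,
        HopfTensor.smul_tmul k A W' V x (Coalgebra.Repr.arbitrary k x), map_sum,
        LinearMap.restrictScalars_apply, map_smul]

theorem HopfTensor.mapLeft_surjective {W' : Type*} [AddCommGroup W']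
    [Module k W'] [Module A W'] [IsScalarTower k A W'] {f : W →ₗ[A] W'}
    (hf : Function.Surjective f) : Function.Surjective (HopfTensor.mapLeft (k := k) V f) :=
  (HopfTensor.equiv k A W' V).surjective.comp <|
    (LinearMap.rTensor_surjective V (g := f.restrictScalars k) hf).comp
      (HopfTensor.equiv k A W V).symm.surjective

theorem hopfTensorHomEquiv_comp [FiniteDimensional k V] {W' : Type*} [AddCommGroup W']
    [Module k W'] [Module A W'] [IsScalarTower k A W'] (f : W →ₗ[A] W')
    (g : HopfTensor k A P V →ₗ[A] W) :
    hopfTensorHomEquiv (k := k) (f ∘ₗ g) =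
      HopfTensor.mapLeft (HopfDual k A V) f ∘ₗ hopfTensorHomEquiv g := by
  ext p
  apply (hopfTensorDualEquivHom k A V W').injective
  ext v
  rw [hopfTensorHomEquiv_apply, LinearMap.comp_apply, LinearMap.comp_apply]
  change _ = hopfTensorDualEquivHom k A V W' (HopfTensor.equiv k A W' (HopfDual k A V)
      ((f.restrictScalars k).rTensor (HopfDual k A V)
        ((HopfTensor.equiv k A W (HopfDual k A V)).symm (hopfTensorHomEquiv g p)))) v
  rw [hopfTensorDualEquivHom_map, LinearEquiv.apply_symm_apply, LinearMap.comp_apply,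
    hopfTensorHomEquiv_apply]
  rfl

theorem HopfTensor.projective [FiniteDimensional k V] (hP : Module.Projective A P) :
    Module.Projective A (HopfTensor k A P V) := by
  refine Module.Projective.of_lifting_property'' fun f hf => ?_
  obtain ⟨h, hh⟩ := Module.projective_lifting_property
    (HopfTensor.mapLeft (k := k) (HopfDual k A V) f) (hopfTensorHomEquiv LinearMap.id)
    (HopfTensor.mapLeft_surjective hf)
  refine ⟨hopfTensorHomEquiv.symm h, (hopfTensorHomEquiv (k := k)).injective ?_⟩
  rw [hopfTensorHomEquiv_comp, LinearEquiv.apply_symm_apply, hh]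

theorem moduleTrace_hopfTensor [FiniteDimensional k P] [FiniteDimensional k V] {x : A} {κ : Type*}
    (R : Coalgebra.Repr k x κ) : moduleTrace k A (HopfTensor k A P V) x =
      ∑ i ∈ R.index, moduleTrace k A V (R.right i) * moduleTrace k A P (R.left i) := by
  have h : tensorAction k A P V x = ∑ i ∈ R.index,
      TensorProduct.map (moduleAction k A P (R.left i)) (moduleAction k A V (R.right i)) := by
    ext p v
    have := HopfTensor.smul_tmul k A P V x R p v
    rw [HopfTensor.smul_equiv] at this
    simpa [moduleAction, LinearMap.sum_apply] using (HopfTensor.equiv k A P V).injective this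
  have h' : moduleTrace k A (HopfTensor k A P V) x =
      LinearMap.trace k (P ⊗[k] V) (tensorAction k A P V x) := rfl
  rw [h', h, map_sum]
  exact Finset.sum_congr rfl fun i _ => by
    rw [LinearMap.trace_tensorProduct', mul_comm]
    rfl

theorem finrank_hopfTensor (k A V W : Type*) [Field k] [AddCommGroup V] [Module k V]
    [AddCommGroup W] [Module k W] : Module.finrank k (HopfTensor k A V W) =
      Module.finrank k V * Module.finrank k W :=
  Module.finrank_tensorProduct

theorem finrank_hopfDual (k A V : Type*) [Field k] [AddCommGroup V] [Module k V] :
    Module.finrank k (HopfDual k A V) = Module.finrank k V :=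
  Subspace.dual_finrank_eq

/-- The isomorphism `id ⊗ e` for an isomorphism `e` of `A`-modules. -/
noncomputable def HopfTensor.congrRight (W : Type*) [AddCommGroup W] [Module k W] [Module A W]
    [IsScalarTower k A W] {V' : Type*} [AddCommGroup V'] [Module k V'] [Module A V']
    [IsScalarTower k A V'] (e : V ≃ₗ[A] V') : HopfTensor k A W V ≃ₗ[A] HopfTensor k A W V' :=
  { (HopfTensor.equiv k A W V).symm ≪≫ₗ (e.restrictScalars k).lTensor W ≪≫ₗ
      HopfTensor.equiv k A W V' with
    map_smul' := fun x t => by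
      obtain ⟨t, rfl⟩ := (HopfTensor.equiv k A W V).surjective t
      induction t with
      | zero => simp
      | add s t hs ht => simp_all [map_add, smul_add]
      | tmul w v =>
        rw [HopfTensor.smul_tmul k A W V x (Coalgebra.Repr.arbitrary k x)]
        simp [HopfTensor.smul_tmul k A W V' x (Coalgebra.Repr.arbitrary k x)] }

end Adjunction

section McKayEigenvectors

variable {k : Type*} {A : Type u} [Field k] [IsAlgClosed k] [Ring A] [HopfAlgebra k A]
  [FiniteDimensional k A] {ι : Type*}
  {S : ι → Type*} [∀ i, AddCommGroup (S i)] [∀ i, Module k (S i)] [∀ i, Module A (S i)]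
  [∀ i, IsScalarTower k A (S i)]
  {P : ι → Type*} [∀ i, AddCommGroup (P i)] [∀ i, Module k (P i)] [∀ i, Module A (P i)]
  [∀ i, IsScalarTower k A (P i)] [∀ i, FiniteDimensional k (P i)]
  (V : Type*) [AddCommGroup V] [Module k V] [Module A V] [IsScalarTower k A V]
  [FiniteDimensional k V]

theorem mcKayMatrix_apply (hS : IsCompleteSimpleFamily A S)
    (hP : ∀ i, IsProjectiveCoverOfSimple A (P i) (S i)) (i j : ι) :
    mcKayMatrix k A S V i j = Module.finrank k (P j →ₗ[A] HopfTensor k A (S i) V) := by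
  have := hS.simple
  have : FiniteDimensional k (S i) := IsSimpleModule.finiteDimensional k A (S i)
  exact (hP j).compositionMultiplicity_eq_finrank_hom

theorem mcKayMatrix_dual_apply (hS : IsCompleteSimpleFamily A S)
    (hP : ∀ i, IsProjectiveCoverOfSimple A (P i) (S i)) (i j : ι) :
    mcKayMatrix k A S (HopfDual k A V) i j =
      Module.finrank k (HopfTensor k A (P j) V →ₗ[A] S i) :=
  (mcKayMatrix_apply _ hS hP i j).trans hopfTensorHomEquiv.finrank_eq.symm

theorem mcKayMatrix_congr (hS : IsCompleteSimpleFamily A S)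
    (hP : ∀ i, IsProjectiveCoverOfSimple A (P i) (S i)) {V V' : Type*}
    [AddCommGroup V] [Module k V] [Module A V] [IsScalarTower k A V] [FiniteDimensional k V]
    [AddCommGroup V'] [Module k V'] [Module A V'] [IsScalarTower k A V'] [FiniteDimensional k V']
    (e : V ≃ₗ[A] V') : mcKayMatrix k A S V = mcKayMatrix k A S V' := by
  ext i j
  rw [mcKayMatrix_apply V hS hP, mcKayMatrix_apply V' hS hP]
  exact finrank_hom_congr_right (HopfTensor.congrRight (S i) e)

variable [Fintype ι]

theorem traceVector_vecMul_mcKayMatrix_dual (hS : IsCompleteSimpleFamily A S)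
    (hP : ∀ i, IsProjectiveCoverOfSimple A (P i) (S i)) {x : A} {κ : Type*}
    (R : Coalgebra.Repr k x κ) :
    traceVector k A P x ᵥ* (mcKayMatrix k A S (HopfDual k A V)).map (Nat.cast : ℕ → k) =
      ∑ t ∈ R.index, moduleTrace k A V (R.right t) • traceVector k A P (R.left t) := by
  ext j
  have h := (hS.moduleTrace_and_finrank_eq_sum (k := k) hP _ (HopfTensor k A (P j) V)
    (HopfTensor.projective (hP j).projective) rfl).1 x
  rw [moduleTrace_hopfTensor R] at h
  rw [Finset.sum_apply]
  simp only [Pi.smul_apply, smul_eq_mul, traceVector]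
  rw [h]
  simp only [Matrix.vecMul, dotProduct, traceVector]
  refine Finset.sum_congr rfl fun i _ => ?_
  rw [Matrix.map_apply, mcKayMatrix_dual_apply V hS hP, mul_comm]

theorem dimensionVector_vecMul_mcKayMatrix_dual (hS : IsCompleteSimpleFamily A S)
    (hP : ∀ i, IsProjectiveCoverOfSimple A (P i) (S i)) :
    dimensionVector k P ᵥ* (mcKayMatrix k A S (HopfDual k A V)).map (Nat.cast : ℕ → ℤ) =
      (Module.finrank k V : ℤ) • dimensionVector k P := by
  ext j
  have h := (hS.moduleTrace_and_finrank_eq_sum (k := k) hP _ (HopfTensor k A (P j) V)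
    (HopfTensor.projective (hP j).projective) rfl).2
  rw [finrank_hopfTensor] at h
  simp only [Pi.smul_apply, smul_eq_mul, dimensionVector]
  rw [mul_comm]
  refine Eq.trans ?_ (congrArg (Nat.cast : ℕ → ℤ) h.symm |>.trans (Nat.cast_mul _ _))
  rw [Nat.cast_sum]
  simp only [Matrix.vecMul, dotProduct, dimensionVector]
  refine Finset.sum_congr rfl fun i _ => ?_
  rw [Matrix.map_apply, mcKayMatrix_dual_apply V hS hP, mul_comm, Nat.cast_mul]

theorem dimensionVector_ne_zero (hS : IsCompleteSimpleFamily A S)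
    (hP : ∀ i, IsProjectiveCoverOfSimple A (P i) (S i)) : dimensionVector k P ≠ 0 := by
  have : Nontrivial A := (Bialgebra.counitAlgHom k A).toRingHom.domain_nontrivial
  obtain ⟨i, -⟩ := hS.exists_surjective A
  have : Nontrivial (P i) := (hP i).indecomposable.1
  intro h
  have h' : (Module.finrank k (P i) : ℤ) = 0 := congrFun h i
  exact Module.finrank_pos.ne' (Nat.cast_eq_zero.1 h')

end McKayEigenvectors

theorem theorem2p11 {k : Type*} {A : Type u} [Field k] [IsAlgClosed k] [Ring A] [HopfAlgebra k A]
    [FiniteDimensional k A] {ι : Type*} [Fintype ι]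
    (S : ι → Type*) [∀ i, AddCommGroup (S i)] [∀ i, Module k (S i)] [∀ i, Module A (S i)]
    [∀ i, IsScalarTower k A (S i)] (hS : IsCompleteSimpleFamily A S)
    (P : ι → Type*) [∀ i, AddCommGroup (P i)] [∀ i, Module k (P i)] [∀ i, Module A (P i)]
    [∀ i, IsScalarTower k A (P i)] [∀ i, FiniteDimensional k (P i)]
    (hP : ∀ i, IsProjectiveCoverOfSimple A (P i) (S i))
    (V : Type*) [AddCommGroup V] [Module k V] [Module A V] [IsScalarTower k A V]
    [FiniteDimensional k V] :
    -- `Tr_P(x) M_{V*} = ∑ tr_V(x₂) Tr_P(x₁)`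
    (∀ (x : A) (κ : Type*) (R : Coalgebra.Repr k x κ),
      traceVector k A P x ᵥ* (mcKayMatrix k A S (HopfDual k A V)).map (Nat.cast : ℕ → k) =
        ∑ t ∈ R.index, moduleTrace k A V (R.right t) • traceVector k A P (R.left t)) ∧
    -- the consequences when `V** ≅ V`
    (Nonempty (HopfDual k A (HopfDual k A V) ≃ₗ[A] V) →
      -- `Tr_P(x) M_V = ∑ tr_{V*}(x₂) Tr_P(x₁)`
      (∀ (x : A) (κ : Type*) (R : Coalgebra.Repr k x κ),
        traceVector k A P x ᵥ* (mcKayMatrix k A S V).map (Nat.cast : ℕ → k) =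
          ∑ t ∈ R.index, moduleTrace k A (HopfDual k A V) (R.right t) •
            traceVector k A P (R.left t)) ∧
      -- grouplike elements
      (∀ g : A, IsGroupLikeElem k g →
        traceVector k A P g ᵥ* (mcKayMatrix k A S V).map (Nat.cast : ℕ → k) =
          moduleTrace k A (HopfDual k A V) g • traceVector k A P g ∧
        (traceVector k A P g ≠ 0 →
          IsLeftEigenvector ((mcKayMatrix k A S V).map (Nat.cast : ℕ → k))
            (moduleTrace k A (HopfDual k A V) g) (traceVector k A P g))) ∧
      -- the case `g = 1` and the dimension vector
      (∀ i, traceVector k A P 1 i = (dimensionVector k P i : k)) ∧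
      moduleTrace k A (HopfDual k A V) 1 = (Module.finrank k (HopfDual k A V) : k) ∧
      Module.finrank k (HopfDual k A V) = Module.finrank k V ∧
      moduleTrace k A V 1 = (Module.finrank k V : k) ∧
      IsLeftEigenvector ((mcKayMatrix k A S V).map (Nat.cast : ℕ → ℤ))
        (Module.finrank k V : ℤ) (dimensionVector k P) ∧
      -- elements with `Δ(x) = x ⊗ y + z ⊗ x`
      (∀ x y z : A, y ≠ 0 → z ≠ 0 →
        (Coalgebra.comul x : A ⊗[k] A) = x ⊗ₜ[k] y + z ⊗ₜ[k] x →
        traceVector k A P x ᵥ* (mcKayMatrix k A S V).map (Nat.cast : ℕ → k) =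
          moduleTrace k A (HopfDual k A V) y • traceVector k A P x +
            moduleTrace k A (HopfDual k A V) x • traceVector k A P z)) := by
  refine ⟨fun x κ R => traceVector_vecMul_mcKayMatrix_dual V hS hP R, fun ⟨e⟩ => ?_⟩
  have hM := mcKayMatrix_congr (k := k) hS hP e
  have hgroup : ∀ g : A, IsGroupLikeElem k g →
      traceVector k A P g ᵥ* (mcKayMatrix k A S V).map (Nat.cast : ℕ → k) =
        moduleTrace k A (HopfDual k A V) g • traceVector k A P g := fun g hg => by
    rw [← hM, traceVector_vecMul_mcKayMatrix_dual (HopfDual k A V) hS hP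
      (⟨{()}, fun _ => g, fun _ => g, by simp [hg.comul_eq_tmul_self]⟩ : Coalgebra.Repr k g Unit),
      Finset.sum_singleton]
  refine ⟨fun x κ R => hM ▸ traceVector_vecMul_mcKayMatrix_dual (HopfDual k A V) hS hP R,
    fun g hg => ⟨hgroup g hg, fun hne => ⟨hne, hgroup g hg⟩⟩,
    fun i => ?_, moduleTrace_one, finrank_hopfDual k A V, moduleTrace_one,
    ⟨dimensionVector_ne_zero hS hP, ?_⟩, fun x y z _ _ hx => ?_⟩
  · simp [traceVector, dimensionVector, moduleTrace_one]
  · rw [← hM, dimensionVector_vecMul_mcKayMatrix_dual (HopfDual k A V) hS hP, finrank_hopfDual]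
  · rw [← hM, traceVector_vecMul_mcKayMatrix_dual (HopfDual k A V) hS hP
      (⟨Finset.univ, fun b => bif b then x else z, fun b => bif b then y else x, by
        simp [hx]⟩ : Coalgebra.Repr k x Bool)]
    simp
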